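/- Let $\Gamma=(X,R)$ be a finite simple connected graph with path-length distance $\partial$ and diameter $d\ge 3$. Write $\Gamma_i(x)=\{z\in X:\partial(x,z)=i\}$. Assume that $\Gamma$ is distance-regular, i.e. for all $0\le h,i,j\le d$ the number $p^h_{ij}=|\Gamma_i(x)\cap\Gamma_j(y)|$ is the same for all $x,y\in X$ with $\partial(x,y)=h$, and that $\Gamma$ is not bipartite. Put $k=p^0_{11}$ (the valency), $a_1=p^1_{11}$ and $b_1=p^1_{12}$. Let $A$ be the adjacency matrix of $\Gamma$, let $\theta_0>\theta_1>\cdots>\theta_d$ be the distinct eigenvalues of $A$, and let $M\subseteq \mathrm{Mat}_X(\mathbb R)$ be the Bose–Mesner algebra of $\Gamma$, i.e. the real algebra generated by $A$. For an eigenvalue $\theta$ of $A$ let $E$ be the associated primitive idempotent of $M$, i.e. the one with $AE=\theta E$. For $x\in X$ let $\hat x\in\mathbb R^X$ be the vector with $1$ in coordinate $x$ and $0$ elsewhere. An edge $xy\in R$ is called tight with respect to $\theta$ if the vectors $$E\hat x,\qquad E\hat y,\qquad \sum_{z\in\Gamma_1(x)\cap\Gamma_1(y)}E\hat z$$ are linearly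 dependent. Then the following are equivalent: (i) $\displaystyle \frac{k+\theta_d(a_1+1)}{(k+\theta_d)(1+\theta_d)}=\frac{k+\theta_1(a_1+1)}{(k+\theta_1)(1+\theta_1)}$; (ii) equality holds in the Fundamental Bound, i.e. $\displaystyle \left(\theta_1+\frac{k}{a_1+1}\right)\left(\theta_d+\frac{k}{a_1+1}\right)=-\frac{ka_1b_1}{(a_1+1)^2}$; (iii) $a_1\neq 0$ and every edge of $\Gamma$ is tight with respect to both $\theta_1$ and $\theta_d$; (iv) $a_1\neq 0$ and some edge of $\Gamma$ is tight with respect to both $\theta_1$ and $\theta_d$. -/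

import Mathlib

open scoped Matrix

namespace SimpleGraph

/-- The number of vertices `z` at distance `i` from `x` and at distance `j` from `y`,
that is, the size of the intersection of the spheres `Γ_i(x)` and `Γ_j(y)`. -/
noncomputable def sphereInter {X : Type*} [Fintype X] (G : SimpleGraph X) (i j : ℕ) (x y : X) :
    ℕ :=
  (Finset.univ.filter fun z : X => G.dist x z = i ∧ G.dist y z = j).card

/-- A finite graph of diameter `d` is distance-regular if it is connected and, for all
`0 ≤ h, i, j ≤ d`, the number `|Γ_i(x) ∩ Γ_j(y)|` is the same for all pairs of vertices `x`, `y`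
at distance `h`. -/
structure IsDistanceRegular {X : Type*} [Fintype X] (G : SimpleGraph X) : Prop where
  connected : G.Connected
  regular : ∀ h i j : ℕ, h ≤ G.diam → i ≤ G.diam → j ≤ G.diam →
    ∀ x y x' y' : X, G.dist x y = h → G.dist x' y' = h →
      G.sphereInter i j x y = G.sphereInter i j x' y'

/-- The intersection number `p^h_{ij}`: the common value of `|Γ_i(x) ∩ Γ_j(y)|` over the pairs
`x`, `y` at distance `h`. It is written as the maximum over these pairs; see
`IsDistanceRegular.sphereInter_eq`. -/
noncomputable def intersectionNumber {X : Type*} [Fintype X] (G : SimpleGraph X) (h i j : ℕ) :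
    ℕ :=
  (Finset.univ.filter fun q : X × X => G.dist q.1 q.2 = h).sup
    fun q => G.sphereInter i j q.1 q.2

/-- In a distance-regular graph every pair at distance `h` attains `p^h_{ij}`. -/
theorem IsDistanceRegular.sphereInter_eq {X : Type*} [Fintype X] {G : SimpleGraph X}
    (hG : G.IsDistanceRegular) {h i j : ℕ} (hh : h ≤ G.diam) (hi : i ≤ G.diam)
    (hj : j ≤ G.diam) {x y : X} (hxy : G.dist x y = h) :
    G.sphereInter i j x y = G.intersectionNumber h i j := by
  refine le_antisymm ?_ ?_
  · exact Finset.le_sup (f := fun q : X × X => G.sphereInter i j q.1 q.2)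
      (b := (x, y)) (by simp [hxy])
  · refine Finset.sup_le fun q hq => ?_
    exact (hG.regular h i j hh hi hj _ _ _ _ (by simpa using hq) hxy).le

/-- The valency `k = b_0 = p^0_{11}`. -/
noncomputable def valency {X : Type*} [Fintype X] (G : SimpleGraph X) : ℕ :=
  G.intersectionNumber 0 1 1

/-- The intersection number `a_i = p^i_{1i}`. -/
noncomputable def intersectionA {X : Type*} [Fintype X] (G : SimpleGraph X) (i : ℕ) : ℕ :=
  G.intersectionNumber i 1 i

/-- The intersection number `b_i = p^i_{1,i+1}`, used for `i < d`. -/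
noncomputable def intersectionB {X : Type*} [Fintype X] (G : SimpleGraph X) (i : ℕ) : ℕ :=
  G.intersectionNumber i 1 (i + 1)

/-- The Bose-Mesner algebra: the subalgebra of `Mat_X(ℝ)` generated by the adjacency matrix. -/
noncomputable def boseMesner {X : Type*} [Fintype X] [DecidableEq X] (G : SimpleGraph X)
    [DecidableRel G.Adj] : Subalgebra ℝ (Matrix X X ℝ) :=
  Algebra.adjoin ℝ {G.adjMatrix ℝ}

/-- `E` is a primitive idempotent of the Bose-Mesner algebra: a nonzero idempotent `E` of it such
that the only idempotents `F` of it with `F * E = F` are `0` and `E`. -/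
structure IsPrimitiveIdempotent {X : Type*} [Fintype X] [DecidableEq X] (G : SimpleGraph X)
    [DecidableRel G.Adj] (E : Matrix X X ℝ) : Prop where
  mem : E ∈ G.boseMesner
  ne_zero : E ≠ 0
  idem : E * E = E
  minimal : ∀ F ∈ G.boseMesner, F * F = F → F * E = F → F = 0 ∨ F = E

/-- `E` is the primitive idempotent associated with the eigenvalue `θ`, i.e. `A E = θ E`. -/
def IsPrimitiveIdempotentOf {X : Type*} [Fintype X] [DecidableEq X] (G : SimpleGraph X)
    [DecidableRel G.Adj] (θ : ℝ) (E : Matrix X X ℝ) : Prop :=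
  G.IsPrimitiveIdempotent E ∧ G.adjMatrix ℝ * E = θ • E

/-- The edge `xy` is tight with respect to `θ`: for the primitive idempotent `E` associated with
`θ`, the three vectors `E x̂`, `E ŷ` and `∑ E ẑ`, summed over the common neighbours `z` of `x`
and `y`, are linearly dependent. Here `x̂ = Pi.single x 1`. -/
def IsTightEdge {X : Type*} [Fintype X] [DecidableEq X] (G : SimpleGraph X)
    [DecidableRel G.Adj] (θ : ℝ) (x y : X) : Prop :=
  G.Adj x y ∧ ∃ E : Matrix X X ℝ, G.IsPrimitiveIdempotentOf θ E ∧
    ¬ LinearIndependent ℝ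
      ![E *ᵥ (Pi.single x 1 : X → ℝ), E *ᵥ (Pi.single y 1 : X → ℝ),
        ∑ z with G.Adj x z ∧ G.Adj y z, E *ᵥ (Pi.single z 1 : X → ℝ)]

end SimpleGraph

/-!
The argument is a Gram determinant. Entries of a matrix in the Bose-Mesner algebra depend on the
distance only (`IsDistanceRegular.exists_apply_dist`), so for the primitive idempotent `E` of an
eigenvalue `t` and an edge `xy`, the Gram matrix of `E x̂`, `E ŷ` and the sum of the `E ẑ` over the
common neighbours `z` involves only `f 0`, `f 1`, `f 2`, where `E u v = f (dist u v)`, and the number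
`F` of ordered pairs of common neighbours at distance `2`. As `A E = t E` gives `f 1` and `f 2` in
terms of `f 0`, nonnegativity of the determinant for `-k < t < k` becomes
`F (k + t) (1 + t) ≤ a₁ b₁ (k + t (a₁ + 1))`, with equality exactly if the edge is tight
(`IsCosineSequence.commonPairs_le_and_eq_iff`, `IsDistanceRegular.isTightEdge_iff`).

Since `-k < θ_d < -1 < θ_1 < k`, where the first inequality is the one that needs a graph that is
not bipartite, dividing gives an upper bound for `F` from `θ_1` and a lower bound from `θ_d`. Up
to the factor `a₁ b₁` these are the two fractions of the first condition. If they are equal, `F`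
attains both bounds on every edge; if one edge is tight for both eigenvalues and `a₁ ≠ 0`, they
are equal. For `a₁ = 0` both fractions are of the form `1 / (1 + θ)` and differ. That equality of
the fractions is equality in the Fundamental Bound is algebra from `k = 1 + a₁ + b₁`
(`fraction_eq_iff_fundamental_bound`).
-/

/-! ### The Gram matrix of three vectors -/

/-- The Gram determinant of three vectors two of which have equal norms and equal inner products
with the third, up to the positive factor `a - b`. -/
theorem gram_three_nonneg_and_eq_zero_iff {X : Type*} [Fintype X] {u v w : X → ℝ} {a b c : ℝ}
    (huu : u ⬝ᵥ u = a) (hvv : v ⬝ᵥ v = a) (huv : u ⬝ᵥ v = b) (huw : u ⬝ᵥ w = c)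
    (hvw : v ⬝ᵥ w = c) (hab : -a < b) (hba : b < a) :
    0 ≤ (a + b) * (w ⬝ᵥ w) - 2 * c ^ 2 ∧
      ((a + b) * (w ⬝ᵥ w) - 2 * c ^ 2 = 0 ↔ ¬ LinearIndependent ℝ ![u, v, w]) := by
  have hvu : v ⬝ᵥ u = b := by rw [dotProduct_comm, huv]
  have hwu : w ⬝ᵥ u = c := by rw [dotProduct_comm, huw]
  have hwv : w ⬝ᵥ v = c := by rw [dotProduct_comm, hvw]
  -- up to scaling, the component of `w` orthogonal to `u` and `v`
  set r : X → ℝ := (a + b) • w - c • (u + v) with hr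
  have hrr : r ⬝ᵥ r = (a + b) * ((a + b) * (w ⬝ᵥ w) - 2 * c ^ 2) := by
    simp only [hr, sub_dotProduct, dotProduct_sub, smul_dotProduct, dotProduct_smul,
      add_dotProduct, dotProduct_add, smul_eq_mul, huu, hvv, huv, hvu, huw, hvw, hwu, hwv]
    ring
  have hpos : 0 < a + b := by linarith
  refine ⟨?_, ?_, ?_⟩
  · have : 0 ≤ r ⬝ᵥ r := by simpa using dotProduct_star_self_nonneg r
    rw [hrr] at this
    exact nonneg_of_mul_nonneg_right this hpos
  · intro h0 hli
    rw [h0, mul_zero, dotProduct_self_eq_zero] at hrr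
    have h := Fintype.linearIndependent_iff.1 hli ![-c, -c, a + b] (by
      rw [← hrr, hr]
      simp [Fin.sum_univ_three]
      module) 2
    simp at h
    linarith
  · intro hli
    rw [Fintype.linearIndependent_iff] at hli
    push Not at hli
    obtain ⟨g, hg, i, hi⟩ := hli
    have hg' : g 0 • u + g 1 • v + g 2 • w = 0 := by simpa [Fin.sum_univ_three] using hg
    have e1 := congrArg (u ⬝ᵥ ·) hg'
    have e2 := congrArg (v ⬝ᵥ ·) hg'
    have e3 := congrArg (w ⬝ᵥ ·) hg'
    simp only [dotProduct_add, dotProduct_smul, smul_eq_mul, dotProduct_zero, huu, hvv, huv, hvu,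
      huw, hvw, hwu, hwv] at e1 e2 e3
    have h01 : g 0 = g 1 := by
      have : (g 0 - g 1) * (a - b) = 0 := by linear_combination e1 - e2
      rcases mul_eq_zero.1 this with h | h <;> linarith
    have hg2 : g 2 ≠ 0 := by
      intro h2
      have h0 : g 0 = 0 := by
        have : g 0 * (a + b) = 0 := by rw [h2, ← h01] at e1; linear_combination e1
        rcases mul_eq_zero.1 this with h | h <;> linarith
      fin_cases i
      · exact hi h0
      · exact hi (h01 ▸ h0)
      · exact hi h2
    refine (mul_eq_zero.1 ?_).resolve_left hg2
    rw [← h01] at e1 e3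
    linear_combination (a + b) * e3 - 2 * c * e1

namespace SimpleGraph

variable {X : Type*} {G : SimpleGraph X}

/-! ### Counting in a distance-regular graph -/

/-- Two vertices with a common neighbour are at distance at most `2`. -/
theorem Connected.dist_le_two (hc : G.Connected) {x y z : X} (hy : G.Adj x y) (hz : G.Adj x z) :
    G.dist y z ≤ 2 := by
  have h := hc.dist_triangle (u := y) (v := x) (w := z)
  rwa [dist_eq_one_iff_adj.2 hy.symm, dist_eq_one_iff_adj.2 hz] at h

/-- The value of `f` at a distance at most `2`, in a form that is easy to sum over `y` and `z`. -/
theorem Connected.apply_dist_eq [DecidableEq X] (hc : G.Connected) (f : ℕ → ℝ) {y z : X}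
    (h : G.dist y z ≤ 2) :
    f (G.dist y z) = f 1 + (if y = z then f 0 - f 1 else 0) +
      (if G.dist y z = 2 then f 2 - f 1 else 0) := by
  have h0 := hc.dist_eq_zero_iff (u := y) (v := z)
  generalize G.dist y z = n at h h0 ⊢
  interval_cases n
  · rw [if_pos (h0.1 rfl)]; simp
  · rw [if_neg (fun h => by simpa using h0.2 h)]; simp
  · rw [if_neg (fun h => by simpa using h0.2 h)]; simp

theorem isSelfAdjoint_adjMatrix [DecidableRel G.Adj] : IsSelfAdjoint (G.adjMatrix ℝ) := by
  rw [IsSelfAdjoint, Matrix.star_eq_conjTranspose, Matrix.conjTranspose_eq_transpose_of_trivial,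
    transpose_adjMatrix]

variable [Fintype X]

theorem IsDistanceRegular.dist_le_diam (hG : G.IsDistanceRegular) (x y : X) :
    G.dist x y ≤ G.diam := by
  have : Nonempty X := hG.connected.nonempty
  exact SimpleGraph.dist_le_diam (connected_iff_ediam_ne_top.1 hG.connected)

/-- In a graph of diameter at least `2` some vertex has two neighbours at distance `2`. -/
theorem IsDistanceRegular.exists_path_two (hG : G.IsDistanceRegular) (hd : 2 ≤ G.diam) :
    ∃ x y z : X, G.Adj x y ∧ G.Adj y z ∧ G.dist x z = 2 := by
  have : Nonempty X := hG.connected.nonempty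
  obtain ⟨u, v, huv⟩ := G.exists_dist_eq_diam
  obtain ⟨p, hp⟩ := hG.connected.exists_walk_length_eq_dist u v
  obtain ⟨x, y, z, hxy, hyz, hxz, hne⟩ := Walk.exists_adj_adj_not_adj_ne hp (by omega)
  have h1 := hG.connected.dist_le_two hxy.symm hyz
  have h2 := hG.connected.one_lt_dist_of_ne_of_not_adj hne hxz
  exact ⟨x, y, z, hxy, hyz, by omega⟩

variable [DecidableRel G.Adj]

theorem IsDistanceRegular.degree_eq (hG : G.IsDistanceRegular) (hd : 1 ≤ G.diam) (x : X) :
    G.degree x = G.valency := by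
  rw [valency, ← hG.sphereInter_eq (x := x) (y := x) (Nat.zero_le _) hd hd (by simp),
    sphereInter, ← card_neighborFinset_eq_degree]
  congr 1
  ext z
  simp [dist_eq_one_iff_adj]

theorem IsDistanceRegular.card_common (hG : G.IsDistanceRegular) (hd : 1 ≤ G.diam) {x y : X}
    (hxy : G.Adj x y) :
    (Finset.univ.filter fun z => G.Adj x z ∧ G.Adj y z).card = G.intersectionA 1 := by
  rw [intersectionA, ← hG.sphereInter_eq hd hd hd (dist_eq_one_iff_adj.2 hxy), sphereInter]
  simp [dist_eq_one_iff_adj]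

theorem IsDistanceRegular.card_dist_two (hG : G.IsDistanceRegular) (hd : 2 ≤ G.diam) {x y : X}
    (hxy : G.Adj x y) :
    ((G.neighborFinset x).filter fun z => G.dist z y = 2).card = G.intersectionB 1 := by
  rw [intersectionB, ← hG.sphereInter_eq (by omega) (by omega) hd (dist_eq_one_iff_adj.2 hxy),
    sphereInter]
  congr 1
  ext z
  simp [dist_eq_one_iff_adj, dist_comm]

theorem IsDistanceRegular.intersectionB_pos (hG : G.IsDistanceRegular) (hd : 2 ≤ G.diam) :
    0 < G.intersectionB 1 := by
  obtain ⟨x, y, z, hxy, hyz, hxz⟩ := hG.exists_path_two hd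
  rw [← hG.card_dist_two hd hxy.symm, Finset.card_pos]
  exact ⟨z, by simp [hyz, dist_comm, hxz]⟩

variable [DecidableEq X]

/-- Summing a function of the distance to `y` over the neighbours of a neighbour `x` of `y`. -/
theorem IsDistanceRegular.sum_neighbor (hG : G.IsDistanceRegular) (hd : 2 ≤ G.diam) {x y : X}
    (hxy : G.Adj x y) (f : ℕ → ℝ) :
    ∑ z ∈ G.neighborFinset x, f (G.dist z y) =
      G.valency * f 1 + (f 0 - f 1) + G.intersectionB 1 * (f 2 - f 1) := by
  have h : ∀ z ∈ G.neighborFinset x, f (G.dist z y) = f 1 + (if z = y then f 0 - f 1 else 0) +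
      (if G.dist z y = 2 then f 2 - f 1 else 0) := fun z hz =>
    hG.connected.apply_dist_eq f
      (hG.connected.dist_le_two ((mem_neighborFinset ..).1 hz) hxy)
  rw [Finset.sum_congr rfl h, Finset.sum_add_distrib, Finset.sum_add_distrib,
    Finset.sum_ite_eq', if_pos ((mem_neighborFinset ..).2 hxy), Finset.sum_const,
    ← Finset.sum_filter, Finset.sum_const, hG.card_dist_two hd hxy,
    card_neighborFinset_eq_degree, hG.degree_eq (by omega), nsmul_eq_mul, nsmul_eq_mul]

/-- The number of ordered pairs of common neighbours of `x` and `y` that are at distance `2`. -/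
noncomputable def commonPairs (G : SimpleGraph X) [DecidableRel G.Adj] (x y : X) : ℕ :=
  ∑ z with G.Adj x z ∧ G.Adj y z, ((Finset.univ.filter fun w => G.Adj x w ∧ G.Adj y w).filter
    fun w => G.dist z w = 2).card

/-- Summing a function of the distance over the ordered pairs of common neighbours of `x` and `y`. -/
theorem IsDistanceRegular.sum_common (hG : G.IsDistanceRegular) (hd : 1 ≤ G.diam) {x y : X}
    (hxy : G.Adj x y) (f : ℕ → ℝ) :
    (∑ z with G.Adj x z ∧ G.Adj y z, ∑ w with G.Adj x w ∧ G.Adj y w, f (G.dist z w)) =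
      (G.intersectionA 1 : ℝ) ^ 2 * f 1 + G.intersectionA 1 * (f 0 - f 1) +
        G.commonPairs x y * (f 2 - f 1) := by
  have h : ∀ z ∈ Finset.univ.filter (fun z => G.Adj x z ∧ G.Adj y z),
      (∑ w with G.Adj x w ∧ G.Adj y w, f (G.dist z w)) =
        G.intersectionA 1 * f 1 + (f 0 - f 1) +
        ((Finset.univ.filter fun w => G.Adj x w ∧ G.Adj y w).filter
          fun w => G.dist z w = 2).card * (f 2 - f 1) := by
    intro z hz
    have h' : ∀ w ∈ Finset.univ.filter (fun w => G.Adj x w ∧ G.Adj y w), f (G.dist z w) =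
        f 1 + (if z = w then f 0 - f 1 else 0) + (if G.dist z w = 2 then f 2 - f 1 else 0) :=
      fun w hw => hG.connected.apply_dist_eq f (hG.connected.dist_le_two
        (Finset.mem_filter.1 hz).2.1 (Finset.mem_filter.1 hw).2.1)
    rw [Finset.sum_congr rfl h', Finset.sum_add_distrib, Finset.sum_add_distrib,
      Finset.sum_ite_eq, if_pos hz, Finset.sum_const, ← Finset.sum_filter, Finset.sum_const,
      hG.card_common hd hxy, nsmul_eq_mul, nsmul_eq_mul]
  rw [Finset.sum_congr rfl h, Finset.sum_add_distrib, ← Finset.sum_mul, Finset.sum_const,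
    hG.card_common hd hxy, commonPairs, nsmul_eq_mul]
  push_cast
  ring

theorem IsDistanceRegular.valency_eq (hG : G.IsDistanceRegular) (hd : 2 ≤ G.diam) {x y : X}
    (hxy : G.Adj x y) : (G.valency : ℝ) = 1 + G.intersectionA 1 + G.intersectionB 1 := by
  -- sum the indicator function of distance `1`: its sum is the number of common neighbours
  have h := hG.sum_neighbor hd hxy (fun n => if n = 1 then 1 else 0)
  rw [← Finset.sum_filter, Finset.sum_const, nsmul_eq_mul] at h
  have h2 : ((G.neighborFinset x).filter fun z => G.dist z y = 1).card = G.intersectionA 1 := by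
    rw [← hG.card_common (by omega) hxy]
    congr 1
    ext z
    simp [dist_eq_one_iff_adj, adj_comm]
  rw [h2] at h
  simp at h
  linarith

/-! ### The Bose-Mesner algebra -/

/-- The entries of a matrix in the Bose-Mesner algebra depend on the distance only. -/
theorem IsDistanceRegular.exists_apply_dist (hG : G.IsDistanceRegular) {M : Matrix X X ℝ}
    (hM : M ∈ G.boseMesner) : ∃ f : ℕ → ℝ, ∀ x y, M x y = f (G.dist x y) := by
  refine Algebra.adjoin_induction (p := fun M _ => ∃ f : ℕ → ℝ, ∀ x y, M x y = f (G.dist x y))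
    ?_ ?_ ?_ ?_ hM
  · rintro _ rfl
    exact ⟨fun n => if n = 1 then 1 else 0, fun x y => by
      simp [adjMatrix_apply, dist_eq_one_iff_adj]⟩
  · intro r
    exact ⟨fun n => if n = 0 then r else 0, fun x y => by
      simp [Matrix.algebraMap_matrix_apply, hG.connected.dist_eq_zero_iff]⟩
  · rintro M N - - ⟨f, hf⟩ ⟨g, hg⟩
    exact ⟨f + g, fun x y => by simp [hf, hg]⟩
  · rintro M N - - ⟨f, hf⟩ ⟨g, hg⟩
    refine ⟨fun h => ∑ i ∈ Finset.range (G.diam + 1), ∑ j ∈ Finset.range (G.diam + 1),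
      G.intersectionNumber h i j * (f i * g j), fun x y => ?_⟩
    have hs : ∀ i ∈ Finset.range (G.diam + 1), ∀ j ∈ Finset.range (G.diam + 1),
        (G.intersectionNumber (G.dist x y) i j : ℝ) * (f i * g j) =
          ∑ z : X, if G.dist x z = i ∧ G.dist y z = j then f i * g j else 0 := by
      intro i hi j hj
      rw [← hG.sphereInter_eq (hG.dist_le_diam x y) (Finset.mem_range_succ_iff.1 hi)
        (Finset.mem_range_succ_iff.1 hj) rfl, sphereInter, ← Finset.sum_filter, Finset.sum_const,
        nsmul_eq_mul]
    beta_reduce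
    rw [Finset.sum_congr rfl fun i hi => Finset.sum_congr rfl (hs i hi), Matrix.mul_apply]
    simp_rw [Finset.sum_comm (t := Finset.univ)]
    refine Finset.sum_congr rfl fun z _ => ?_
    have h1 := Finset.mem_range_succ_iff.2 (hG.dist_le_diam x z)
    have h2 := Finset.mem_range_succ_iff.2 (hG.dist_le_diam y z)
    rw [Finset.sum_eq_single_of_mem _ h1, Finset.sum_eq_single_of_mem _ h2, if_pos ⟨rfl, rfl⟩, hf,
      hg, dist_comm (u := z)]
    · exact fun j _ hj => if_neg fun h => hj h.2.symm
    · exact fun i _ hi => Finset.sum_eq_zero fun j _ => if_neg fun h => hi h.1.symm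

theorem mem_boseMesner_iff {M : Matrix X X ℝ} :
    M ∈ G.boseMesner ↔ ∃ p : Polynomial ℝ, Polynomial.aeval (G.adjMatrix ℝ) p = M := by
  rw [boseMesner, Algebra.adjoin_singleton_eq_range_aeval]
  rfl

/-- Polynomials that agree on the spectrum of `A` agree on `A`, as `A` is diagonalizable. -/
theorem aeval_adjMatrix_congr {p q : Polynomial ℝ}
    (h : ∀ t ∈ spectrum ℝ (G.adjMatrix ℝ), p.eval t = q.eval t) :
    Polynomial.aeval (G.adjMatrix ℝ) p = Polynomial.aeval (G.adjMatrix ℝ) q := by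
  have hA := isSelfAdjoint_adjMatrix (G := G)
  rw [← cfc_polynomial p _ hA, ← cfc_polynomial q _ hA]
  exact cfc_congr h

/-- A polynomial that is nonnegative on the spectrum of `A` is positive semidefinite at `A`. -/
theorem posSemidef_aeval_adjMatrix {p : Polynomial ℝ}
    (h : ∀ t ∈ spectrum ℝ (G.adjMatrix ℝ), 0 ≤ p.eval t) :
    (Polynomial.aeval (G.adjMatrix ℝ) p).PosSemidef := by
  open scoped MatrixOrder in
  rw [← Matrix.nonneg_iff_posSemidef, ← cfc_polynomial p _ (isSelfAdjoint_adjMatrix (G := G))]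
  exact cfc_nonneg h

/-- Every eigenvalue has a primitive idempotent: the Lagrange polynomial of the spectrum that is
`1` at the eigenvalue, evaluated at `A`. -/
theorem exists_isPrimitiveIdempotentOf {t : ℝ} (ht : t ∈ spectrum ℝ (G.adjMatrix ℝ)) :
    ∃ E, G.IsPrimitiveIdempotentOf t E := by
  have hfin : (spectrum ℝ (G.adjMatrix ℝ)).Finite := Matrix.finite_real_spectrum
  set q := Lagrange.basis hfin.toFinset id t with hq
  have hq1 : q.eval t = 1 :=
    Lagrange.eval_basis_self (Set.injOn_id _) (hfin.mem_toFinset.2 ht)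
  have hq0 : ∀ s ∈ spectrum ℝ (G.adjMatrix ℝ), s ≠ t → q.eval s = 0 := fun s hs hst =>
    Lagrange.eval_basis_of_ne (v := id) hst.symm (hfin.mem_toFinset.2 hs)
  have hmul : ∀ p : Polynomial ℝ, Polynomial.aeval (G.adjMatrix ℝ) p *
      Polynomial.aeval (G.adjMatrix ℝ) q = p.eval t • Polynomial.aeval (G.adjMatrix ℝ) q := by
    intro p
    rw [← map_mul, ← map_smul]
    refine aeval_adjMatrix_congr fun s hs => ?_
    by_cases hst : s = t
    · subst hst; simp
    · simp [hq0 s hs hst]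
  refine ⟨Polynomial.aeval (G.adjMatrix ℝ) q, ⟨mem_boseMesner_iff.2 ⟨q, rfl⟩, ?_, ?_, ?_⟩, ?_⟩
  · intro h0
    have hX : Nontrivial (Matrix X X ℝ) := by
      by_contra hX
      rw [not_nontrivial_iff_subsingleton] at hX
      simp [spectrum.of_subsingleton] at ht
    have := spectrum.subset_polynomial_aeval (G.adjMatrix ℝ) q ⟨t, ht, hq1⟩
    rw [h0, spectrum.zero_eq] at this
    exact one_ne_zero this
  · rw [hmul, hq1, one_smul]
  · intro F hF hFF hFE
    obtain ⟨p, rfl⟩ := mem_boseMesner_iff.1 hF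
    rw [hmul] at hFE
    by_cases h0 : Polynomial.aeval (G.adjMatrix ℝ) p = 0
    · exact Or.inl h0
    right
    -- `F = c • E` with `c = p.eval t`, so `F * F = c • F`
    have hcF : p.eval t • Polynomial.aeval (G.adjMatrix ℝ) p =
        (1 : ℝ) • Polynomial.aeval (G.adjMatrix ℝ) p := by
      rw [one_smul]
      nth_rw 1 [← hFE]
      rw [← hmul, ← mul_smul_comm, hFE, hFF]
    rw [← hFE, smul_left_injective ℝ h0 hcF, one_smul]
  · simpa using hmul Polynomial.X

/-! ### Primitive idempotents -/

/-- `f` is the cosine sequence of `E`, up to scaling: the entry of the primitive idempotent `E` of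
the eigenvalue `t` at two vertices is the value of `f` at their distance, and the three-term
recurrence of the eigenvalue `t` determines `f 1` and `f 2` from `f 0 > 0`. -/
structure IsCosineSequence (G : SimpleGraph X) [DecidableRel G.Adj] (t : ℝ) (E : Matrix X X ℝ)
    (f : ℕ → ℝ) : Prop where
  apply_eq : ∀ x y, E x y = f (G.dist x y)
  dotProduct_eq : ∀ x y, (E *ᵥ Pi.single x 1) ⬝ᵥ (E *ᵥ Pi.single y 1) = f (G.dist x y)
  pos : 0 < f 0
  one : G.valency * f 1 = t * f 0
  two : G.valency * f 1 + (f 0 - f 1) + G.intersectionB 1 * (f 2 - f 1) = t * f 1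

theorem IsPrimitiveIdempotentOf.exists_isCosineSequence (hG : G.IsDistanceRegular)
    (hd : 2 ≤ G.diam) {t : ℝ} {E : Matrix X X ℝ} (hE : G.IsPrimitiveIdempotentOf t E) :
    ∃ f, G.IsCosineSequence t E f := by
  obtain ⟨f, hf⟩ := hG.exists_apply_dist hE.1.mem
  have hsum : ∀ x y, ∑ z ∈ G.neighborFinset x, f (G.dist z y) = t * f (G.dist x y) := by
    intro x y
    have h := congrFun (congrFun hE.2 x) y
    rw [adjMatrix_mul_apply] at h
    simpa [hf] using h
  have hdot : ∀ x y, (E *ᵥ Pi.single x 1) ⬝ᵥ (E *ᵥ Pi.single y 1) = f (G.dist x y) := by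
    intro x y
    rw [← hf, ← congrFun (congrFun hE.1.idem x) y, Matrix.mul_apply]
    refine Finset.sum_congr rfl fun z _ => ?_
    simp [hf, dist_comm]
  obtain ⟨x, y, -, hxy, -⟩ := hG.exists_path_two hd
  refine ⟨f, hf, hdot, ?_, ?_, ?_⟩
  · refine lt_of_le_of_ne ?_ fun h0 => hE.1.ne_zero ?_
    · rw [← G.dist_self (v := x), ← hdot]
      simpa using dotProduct_star_self_nonneg (E *ᵥ Pi.single x 1)
    · ext u v
      have := hdot v v
      rw [dist_self, ← h0, dotProduct_self_eq_zero] at this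
      simpa using congrFun this u
  · have h := hsum x x
    rw [dist_self] at h
    rw [← h, Finset.sum_congr rfl fun z hz => by
      rw [dist_eq_one_iff_adj.2 ((mem_neighborFinset ..).1 hz).symm]]
    simp [hG.degree_eq (by omega : 1 ≤ G.diam)]
  · rw [← hG.sum_neighbor hd hxy, hsum, dist_eq_one_iff_adj.2 hxy]

/-- The Cauchy-Schwarz inequality for `E x̂` and `E ŷ`. -/
theorem IsCosineSequence.abs_le {t : ℝ} {E : Matrix X X ℝ} {f : ℕ → ℝ}
    (hf : G.IsCosineSequence t E f) {x y : X} (hxy : G.Adj x y) : |f 1| ≤ f 0 := by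
  have h1 := dotProduct_star_self_nonneg (E *ᵥ Pi.single x 1 - E *ᵥ Pi.single y 1)
  have h2 := dotProduct_star_self_nonneg (E *ᵥ Pi.single x 1 + E *ᵥ Pi.single y 1)
  simp only [star_trivial, sub_dotProduct, dotProduct_sub, add_dotProduct, dotProduct_add,
    hf.dotProduct_eq, dist_self, dist_eq_one_iff_adj.2 hxy, dist_eq_one_iff_adj.2 hxy.symm]
    at h1 h2
  rw [_root_.abs_le]
  constructor <;> linarith

theorem IsDistanceRegular.valency_pos (hG : G.IsDistanceRegular) (hd : 2 ≤ G.diam) :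
    (0 : ℝ) < G.valency := by
  obtain ⟨x, y, -, hxy, -⟩ := hG.exists_path_two hd
  rw [hG.valency_eq hd hxy]
  positivity

theorem IsDistanceRegular.abs_le_valency (hG : G.IsDistanceRegular) (hd : 2 ≤ G.diam) {t : ℝ}
    (ht : t ∈ spectrum ℝ (G.adjMatrix ℝ)) : |t| ≤ G.valency := by
  obtain ⟨E, hE⟩ := exists_isPrimitiveIdempotentOf ht
  obtain ⟨f, hf⟩ := hE.exists_isCosineSequence hG hd
  obtain ⟨x, y, -, hxy, -⟩ := hG.exists_path_two hd
  have h := congrArg abs hf.one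
  rw [abs_mul, abs_mul, abs_of_pos hf.pos, Nat.abs_cast] at h
  have := mul_le_mul_of_nonneg_left (hf.abs_le hxy) (hG.valency_pos hd).le
  exact le_of_mul_le_mul_right (h ▸ this) hf.pos

theorem IsDistanceRegular.valency_mem_spectrum (hG : G.IsDistanceRegular) (hd : 2 ≤ G.diam) :
    (G.valency : ℝ) ∈ spectrum ℝ (G.adjMatrix ℝ) := by
  obtain ⟨x, -⟩ := hG.exists_path_two hd
  rw [spectrum.mem_iff]
  intro hu
  -- the all-ones matrix is annihilated by `k - A`
  have h : (algebraMap ℝ (Matrix X X ℝ) G.valency - G.adjMatrix ℝ) *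
      Matrix.of (fun _ _ => 1) = 0 := by
    ext u v
    rw [sub_mul, Matrix.sub_apply, adjMatrix_mul_apply, ← Algebra.smul_def]
    simp [hG.degree_eq (by omega : 1 ≤ G.diam)]
  have h1 := congrFun (congrFun (hu.mul_right_eq_zero.1 h) x) x
  simp at h1

/-- If `-k` is an eigenvalue then, by the equality case of the Cauchy-Schwarz inequality, adjacent
columns of its idempotent are opposite, and the signs in a row give a `2`-colouring. -/
theorem IsDistanceRegular.isBipartite_of_neg_valency_mem (hG : G.IsDistanceRegular)
    (hd : 2 ≤ G.diam) (ht : -(G.valency : ℝ) ∈ spectrum ℝ (G.adjMatrix ℝ)) : G.IsBipartite := by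
  obtain ⟨E, hE⟩ := exists_isPrimitiveIdempotentOf ht
  obtain ⟨f, hf⟩ := hE.exists_isCosineSequence hG hd
  obtain ⟨x₀, -⟩ := hG.exists_path_two hd
  have h1 : f 1 = -f 0 :=
    mul_left_cancel₀ (hG.valency_pos hd).ne' (by linear_combination hf.one)
  have hadj : ∀ {x y}, G.Adj x y → E x₀ y = -E x₀ x := by
    intro x y hxy
    have h : E *ᵥ Pi.single x 1 + E *ᵥ Pi.single y 1 = 0 := by
      rw [← dotProduct_self_eq_zero]
      simp only [add_dotProduct, dotProduct_add, hf.dotProduct_eq, dist_self,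
        dist_eq_one_iff_adj.2 hxy, dist_eq_one_iff_adj.2 hxy.symm, h1]
      ring
    have := congrFun h x₀
    simp at this
    linarith
  have hwalk : ∀ {u v}, G.Walk u v → E x₀ v ≠ 0 → E x₀ u ≠ 0 := by
    intro u v p
    induction p with
    | nil => exact id
    | cons h p ih => exact fun hv => by rw [hadj h.symm]; exact neg_ne_zero.2 (ih hv)
  have hne : ∀ y, E x₀ y ≠ 0 := fun y => by
    obtain ⟨p⟩ := hG.connected y x₀
    exact hwalk p (by rw [hf.apply_eq, dist_self]; exact hf.pos.ne')
  have hcol : G.Coloring Prop := Coloring.mk (fun y => 0 < E x₀ y) fun {x y} hxy h => by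
    have h' := hne x
    rw [hadj hxy] at h
    rcases h'.lt_or_gt with h'' | h''
    · exact absurd (h.mpr (by linarith)) (by linarith)
    · exact absurd (h.mp h'') (by linarith)
  exact hcol.colorable

/-! ### The eigenvalues `θ_1` and `θ_d` -/

/-- The quadratic form of `A - s` is negative on `e_x - e_y + e_z` for a geodesic `x, y, z` unless
`s < -1`. -/
theorem IsDistanceRegular.lt_neg_one (hG : G.IsDistanceRegular) (hd : 2 ≤ G.diam) {s : ℝ}
    (hs : ∀ t ∈ spectrum ℝ (G.adjMatrix ℝ), s ≤ t) : s < -1 := by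
  obtain ⟨x, y, z, hxy, hyz, hxz⟩ := hG.exists_path_two hd
  have h := (posSemidef_aeval_adjMatrix (G := G) (p := .X - .C s) fun t ht => by
    simpa using hs t ht).dotProduct_mulVec_nonneg
      (Pi.single x 1 - Pi.single y 1 + Pi.single z 1)
  have hne : x ≠ z := by rintro rfl; simp at hxz
  have hna : ¬ G.Adj x z := fun h => by rw [dist_eq_one_iff_adj.2 h] at hxz; omega
  have hna' : ¬ G.Adj z x := fun h => hna h.symm
  simp [Matrix.mulVec_add, Matrix.mulVec_sub, Matrix.algebraMap_matrix_apply, hxy, hyz, hxy.symm,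
    hyz.symm, hxy.ne, hxy.ne', hyz.ne, hyz.ne', hne, hne.symm, hna, hna'] at h
  linarith

/-- If `k` and `s` are the two largest eigenvalues, `(A - k) (A - s)` is positive semidefinite; its
quadratic form at `e_x - e_z`, for `x` and `z` at distance `2`, bounds `s` from below. -/
theorem IsDistanceRegular.neg_one_lt (hG : G.IsDistanceRegular) (hd : 2 ≤ G.diam) {s : ℝ}
    (hs : ∀ t ∈ spectrum ℝ (G.adjMatrix ℝ), t = G.valency ∨ t ≤ s) (hsk : s ≤ G.valency) :
    -1 < s := by
  obtain ⟨x, y, z, hxy, hyz, hxz⟩ := hG.exists_path_two hd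
  have h := (posSemidef_aeval_adjMatrix (G := G)
    (p := (.X - .C (G.valency : ℝ)) * (.X - .C s)) fun t ht => by
      rcases hs t ht with h | h
      · simp [h]
      · simpa using mul_nonneg_of_nonpos_of_nonpos (by linarith : t - G.valency ≤ 0)
          (by linarith : t - s ≤ 0)).dotProduct_mulVec_nonneg
      (Pi.single x 1 - Pi.single z 1)
  have hne : x ≠ z := by rintro rfl; simp at hxz
  have hna : ¬ G.Adj x z := fun h => by rw [dist_eq_one_iff_adj.2 h] at hxz; omega
  have hna' : ¬ G.Adj z x := fun h => hna h.symm
  have hAA : ∀ u, (G.adjMatrix ℝ * G.adjMatrix ℝ) u u = G.valency := fun u => by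
    rw [adjMatrix_mul_self_apply_self, hG.degree_eq (by omega)]
  have hpos : ∀ {u v}, G.Adj u y → G.Adj y v →
      0 < (G.adjMatrix ℝ * G.adjMatrix ℝ) u v := fun {u v} hu hv => by
    rw [Matrix.mul_apply]
    refine Finset.sum_pos' (fun w _ => ?_) ⟨y, Finset.mem_univ _, by simp [hu, hv]⟩
    simp only [adjMatrix_apply]
    positivity
  have e : Polynomial.aeval (G.adjMatrix ℝ) ((Polynomial.X - Polynomial.C (G.valency : ℝ)) *
      (Polynomial.X - Polynomial.C s)) =
      G.adjMatrix ℝ * G.adjMatrix ℝ - (G.valency + s) • G.adjMatrix ℝ +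
        (G.valency * s) • 1 := by
    simp only [map_mul, map_sub, Polynomial.aeval_X, Polynomial.aeval_C,
      Algebra.algebraMap_eq_smul_one, sub_mul, mul_sub, smul_mul_assoc, mul_smul_comm, one_mul,
      mul_one]
    module
  rw [e] at h
  have p1 := hpos hxy hyz
  have p2 := hpos hyz.symm hxy.symm
  simp [Matrix.mulVec_sub, hne, hne.symm, hna, hna', hAA, -adjMatrix_mul_apply,
    -mul_adjMatrix_apply] at h
  have := hG.valency_pos hd
  by_contra hcon
  nlinarith

/-! ### Tight edges -/

/-- The Gram matrix of `E x̂`, `E ŷ` and the sum of `E ẑ` over the common neighbours is determined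
by `t` and the number of pairs of common neighbours at distance `2`. Its determinant is nonnegative,
and zero exactly if the edge is tight. -/
theorem IsCosineSequence.commonPairs_le_and_eq_iff (hG : G.IsDistanceRegular) (hd : 2 ≤ G.diam)
    {t : ℝ} {E : Matrix X X ℝ} {f : ℕ → ℝ} (hf : G.IsCosineSequence t E f)
    (hkt : -(G.valency : ℝ) < t) (htk : t < G.valency) {x y : X} (hxy : G.Adj x y) :
    G.commonPairs x y * ((G.valency + t) * (1 + t)) ≤
        G.intersectionA 1 * G.intersectionB 1 * (G.valency + t * (G.intersectionA 1 + 1)) ∧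
      (G.commonPairs x y * ((G.valency + t) * (1 + t)) =
        G.intersectionA 1 * G.intersectionB 1 * (G.valency + t * (G.intersectionA 1 + 1)) ↔
      ¬ LinearIndependent ℝ
        ![E *ᵥ (Pi.single x 1 : X → ℝ), E *ᵥ (Pi.single y 1 : X → ℝ),
          ∑ z with G.Adj x z ∧ G.Adj y z, E *ᵥ (Pi.single z 1 : X → ℝ)]) := by
  have hk := hG.valency_pos hd
  have hb : (0 : ℝ) < G.intersectionB 1 := by exact_mod_cast hG.intersectionB_pos hd
  have hsum : ∀ u, (∀ z, G.Adj x z → G.Adj y z → G.Adj u z) →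
      (E *ᵥ (Pi.single u 1 : X → ℝ)) ⬝ᵥ
        (∑ z with G.Adj x z ∧ G.Adj y z, E *ᵥ (Pi.single z 1 : X → ℝ)) =
      G.intersectionA 1 * f 1 := by
    intro u hu
    rw [dotProduct_sum, Finset.sum_congr rfl fun z hz => by
      rw [hf.dotProduct_eq, dist_eq_one_iff_adj.2
        (hu z (Finset.mem_filter.1 hz).2.1 (Finset.mem_filter.1 hz).2.2)], Finset.sum_const,
      hG.card_common (by omega) hxy, nsmul_eq_mul]
  have hww : (∑ z with G.Adj x z ∧ G.Adj y z, E *ᵥ (Pi.single z 1 : X → ℝ)) ⬝ᵥ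
      (∑ z with G.Adj x z ∧ G.Adj y z, E *ᵥ (Pi.single z 1 : X → ℝ)) =
      (G.intersectionA 1 : ℝ) ^ 2 * f 1 + G.intersectionA 1 * (f 0 - f 1) +
        G.commonPairs x y * (f 2 - f 1) := by
    rw [← hG.sum_common (by omega) hxy]
    simp only [sum_dotProduct, dotProduct_sum, hf.dotProduct_eq]
    exact Finset.sum_comm
  have hl : -f 0 < f 1 := by
    have := hf.pos
    have := hf.one
    by_contra h
    nlinarith
  have hr : f 1 < f 0 := by
    have := hf.pos
    have := hf.one
    by_contra h
    nlinarith
  have key := gram_three_nonneg_and_eq_zero_iff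
    (by rw [hf.dotProduct_eq, dist_self]) (by rw [hf.dotProduct_eq, dist_self])
    (by rw [hf.dotProduct_eq, dist_eq_one_iff_adj.2 hxy])
    (hsum x fun _ h _ => h) (hsum y fun _ _ h => h) hl hr
  rw [hww] at key
  rw [← key.2]
  have hid : G.intersectionB 1 * (G.valency : ℝ) ^ 2 * ((f 0 + f 1) *
      ((G.intersectionA 1 : ℝ) ^ 2 * f 1 + G.intersectionA 1 * (f 0 - f 1) +
        G.commonPairs x y * (f 2 - f 1)) - 2 * (G.intersectionA 1 * f 1) ^ 2) =
      f 0 ^ 2 * (G.valency - t) * (G.intersectionA 1 * G.intersectionB 1 *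
        (G.valency + t * (G.intersectionA 1 + 1)) -
        G.commonPairs x y * ((G.valency + t) * (1 + t))) := by
    obtain ⟨s, hs⟩ : ∃ s, f 1 = s * f 0 := ⟨f 1 / f 0, by field_simp [hf.pos.ne']⟩
    have ht : t = G.valency * s :=
      mul_right_cancel₀ hf.pos.ne' (by rw [← hf.one, hs]; ring)
    have h2 := hf.two
    rw [hs, ht] at h2
    rw [hs, ht]
    linear_combination (G.commonPairs x y * (G.valency : ℝ) ^ 2 * (f 0 + s * f 0)) * h2
  have hc1 : 0 < G.intersectionB 1 * (G.valency : ℝ) ^ 2 := by positivity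
  have hc2 : 0 < f 0 ^ 2 * (G.valency - t) := mul_pos (pow_pos hf.pos 2) (by linarith)
  constructor
  · have := mul_nonneg hc1.le key.1
    rw [hid] at this
    linarith [nonneg_of_mul_nonneg_right this hc2]
  · constructor
    · intro h
      rw [h, sub_self, mul_zero] at hid
      exact (mul_eq_zero.1 hid).resolve_left hc1.ne'
    · intro h
      rw [h, mul_zero] at hid
      linarith [(mul_eq_zero.1 hid.symm).resolve_left hc2.ne']

theorem IsDistanceRegular.commonPairs_le (hG : G.IsDistanceRegular) (hd : 2 ≤ G.diam)
    {t : ℝ} (ht : t ∈ spectrum ℝ (G.adjMatrix ℝ))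
    (hkt : -(G.valency : ℝ) < t) (htk : t < G.valency) {x y : X} (hxy : G.Adj x y) :
    G.commonPairs x y * ((G.valency + t) * (1 + t)) ≤
        G.intersectionA 1 * G.intersectionB 1 * (G.valency + t * (G.intersectionA 1 + 1)) := by
  obtain ⟨E, hE⟩ := exists_isPrimitiveIdempotentOf ht
  obtain ⟨f, hf⟩ := hE.exists_isCosineSequence hG hd
  exact (hf.commonPairs_le_and_eq_iff hG hd hkt htk hxy).1

theorem IsDistanceRegular.isTightEdge_iff (hG : G.IsDistanceRegular) (hd : 2 ≤ G.diam)
    {t : ℝ} (ht : t ∈ spectrum ℝ (G.adjMatrix ℝ))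
    (hkt : -(G.valency : ℝ) < t) (htk : t < G.valency) {x y : X} (hxy : G.Adj x y) :
    G.IsTightEdge t x y ↔ G.commonPairs x y * ((G.valency + t) * (1 + t)) =
        G.intersectionA 1 * G.intersectionB 1 * (G.valency + t * (G.intersectionA 1 + 1)) := by
  constructor
  · rintro ⟨-, E, hE, hli⟩
    obtain ⟨f, hf⟩ := hE.exists_isCosineSequence hG hd
    exact (hf.commonPairs_le_and_eq_iff hG hd hkt htk hxy).2.2 hli
  · intro h
    obtain ⟨E, hE⟩ := exists_isPrimitiveIdempotentOf ht
    obtain ⟨f, hf⟩ := hE.exists_isCosineSequence hG hd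
    exact ⟨hxy, E, hE, (hf.commonPairs_le_and_eq_iff hG hd hkt htk hxy).2.1 h⟩

end SimpleGraph

/-! ### The Fundamental Bound -/

/-- The difference of the two fractions and the defect in the Fundamental Bound differ by a nonzero
factor, as `k = 1 + a + b`. -/
theorem fraction_eq_iff_fundamental_bound {k a b s t : ℝ} (hk : k = 1 + a + b) (ha : a + 1 ≠ 0)
    (hs : (k + s) * (1 + s) ≠ 0) (ht : (k + t) * (1 + t) ≠ 0) (hst : t ≠ s) :
    (k + s * (a + 1)) / ((k + s) * (1 + s)) = (k + t * (a + 1)) / ((k + t) * (1 + t)) ↔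
      (t + k / (a + 1)) * (s + k / (a + 1)) = -(k * a * b / (a + 1) ^ 2) := by
  have e1 : (a + 1) * ((k + s * (a + 1)) * ((k + t) * (1 + t)) -
      (k + t * (a + 1)) * ((k + s) * (1 + s))) =
      (t - s) * (a + 1) ^ 2 *
        ((t + k / (a + 1)) * (s + k / (a + 1)) + k * a * b / (a + 1) ^ 2) := by
    field_simp
    subst hk
    ring
  rw [div_eq_div_iff hs ht, ← sub_eq_zero, eq_neg_iff_add_eq_zero]
  constructor
  · intro h
    rw [h, mul_zero] at e1
    exact (mul_eq_zero.1 e1.symm).resolve_left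
      (mul_ne_zero (sub_ne_zero.2 hst) (pow_ne_zero 2 ha))
  · intro h
    rw [h, mul_zero] at e1
    exact (mul_eq_zero.1 e1).resolve_left ha

theorem corollary6p3 {X : Type*} [Fintype X] [DecidableEq X] (G : SimpleGraph X)
    [DecidableRel G.Adj] (hG : G.IsDistanceRegular) (hbip : ¬ G.IsBipartite)
    (d : ℕ) (hdiam : G.diam = d) (hd : 3 ≤ d)
    (k a₁ b₁ : ℝ) (hk : k = G.valency) (ha₁ : a₁ = G.intersectionA 1)
    (hb₁ : b₁ = G.intersectionB 1)
    -- the eigenvalues `θ_0 > θ_1 > ⋯ > θ_d` of the graph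
    (θ : Fin (d + 1) → ℝ) (hanti : StrictAnti θ)
    (hspec : Set.range θ = spectrum ℝ (G.adjMatrix ℝ))
    (θ₁ θd : ℝ) (hθ₁ : θ₁ = θ ⟨1, by omega⟩) (hθd : θd = θ (Fin.last d)) :
    List.TFAE [
      (k + θd * (a₁ + 1)) / ((k + θd) * (1 + θd)) =
        (k + θ₁ * (a₁ + 1)) / ((k + θ₁) * (1 + θ₁)),
      (θ₁ + k / (a₁ + 1)) * (θd + k / (a₁ + 1)) = -(k * a₁ * b₁ / (a₁ + 1) ^ 2),
      a₁ ≠ 0 ∧ ∀ x y : X, G.Adj x y → G.IsTightEdge θ₁ x y ∧ G.IsTightEdge θd x y,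
      a₁ ≠ 0 ∧ ∃ x y : X, G.Adj x y ∧ G.IsTightEdge θ₁ x y ∧ G.IsTightEdge θd x y] := by
  have hd2 : 2 ≤ G.diam := by omega
  obtain ⟨x₀, y₀, -, hxy₀, -⟩ := hG.exists_path_two hd2
  have hkab := hG.valency_eq hd2 hxy₀
  have hmem₁ : θ₁ ∈ spectrum ℝ (G.adjMatrix ℝ) := hspec ▸ ⟨_, hθ₁.symm⟩
  have hmemd : θd ∈ spectrum ℝ (G.adjMatrix ℝ) := hspec ▸ ⟨_, hθd.symm⟩
  have hd1 : θd < θ₁ := by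
    rw [hθ₁, hθd]
    exact hanti (by rw [Fin.lt_def, Fin.val_last]; exact Nat.lt_of_lt_of_le (by norm_num) hd)
  -- the largest eigenvalue is the valency
  have h0 : θ 0 = G.valency := by
    refine le_antisymm ((le_abs_self _).trans
      (hG.abs_le_valency hd2 (hspec ▸ Set.mem_range_self 0))) ?_
    obtain ⟨i, hi⟩ := hspec.symm ▸ hG.valency_mem_spectrum hd2
    rw [← hi]
    exact hanti.antitone (Fin.zero_le i)
  have h1k : θ₁ < G.valency := by
    rw [← h0, hθ₁]; exact hanti (by rw [Fin.lt_def]; exact Nat.zero_lt_one)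
  have hdk : -(G.valency : ℝ) < θd := by
    refine lt_of_le_of_ne (abs_le.1 (hG.abs_le_valency hd2 hmemd)).1 fun h => hbip ?_
    exact hG.isBipartite_of_neg_valency_mem hd2 (h ▸ hmemd)
  have hdneg : θd < -1 := hG.lt_neg_one hd2 fun t ht => by
    obtain ⟨i, rfl⟩ := hspec.symm ▸ ht
    exact hθd ▸ hanti.antitone (Fin.le_last i)
  have h1pos : -1 < θ₁ := hG.neg_one_lt hd2 (fun t ht => by
    obtain ⟨i, rfl⟩ := hspec.symm ▸ ht
    rcases eq_or_ne i 0 with rfl | hi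
    · exact Or.inl h0
    · right
      rw [hθ₁]
      exact hanti.antitone (by
        rw [Fin.le_def]; exact Nat.one_le_iff_ne_zero.2 fun h => hi (Fin.ext h))) h1k.le
  have hb : (0 : ℝ) < G.intersectionB 1 := by exact_mod_cast hG.intersectionB_pos hd2
  have ha : (0 : ℝ) ≤ G.intersectionA 1 := Nat.cast_nonneg _
  have hD₁ : 0 < ((G.valency : ℝ) + θ₁) * (1 + θ₁) := mul_pos (by linarith) (by linarith)
  have hDd : ((G.valency : ℝ) + θd) * (1 + θd) < 0 :=
    mul_neg_of_pos_of_neg (by linarith) (by linarith)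
  subst hk ha₁ hb₁
  tfae_have 1 ↔ 2 :=
    fraction_eq_iff_fundamental_bound hkab (by linarith) hDd.ne hD₁.ne' hd1.ne'
  tfae_have 1 → 3 := by
    intro h
    refine ⟨fun h0 => ?_, fun x y hxy => ?_⟩
    · -- without triangles both fractions collapse to `1 / (1 + θ)`
      rw [h0] at h
      rw [div_eq_div_iff hDd.ne hD₁.ne'] at h
      have : ((G.valency : ℝ) + θd) * (G.valency + θ₁) * (θ₁ - θd) = 0 := by
        linear_combination h
      have h' : 0 < ((G.valency : ℝ) + θd) * (G.valency + θ₁) * (θ₁ - θd) :=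
        mul_pos (mul_pos (by linarith) (by linarith)) (by linarith)
      exact h'.ne' this
    · -- the two bounds on the number of pairs coincide
      have l1 := hG.commonPairs_le hd2 hmem₁ (by linarith) h1k hxy
      have l2 := hG.commonPairs_le hd2 hmemd hdk (by linarith) hxy
      rw [hG.isTightEdge_iff hd2 hmem₁ (by linarith) h1k hxy,
        hG.isTightEdge_iff hd2 hmemd hdk (by linarith) hxy]
      rw [← eq_div_iff hD₁.ne', ← eq_div_iff hDd.ne, mul_div_assoc, mul_div_assoc, h, and_self]
      rw [← le_div_iff₀ hD₁, mul_div_assoc] at l1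
      rw [← div_le_iff_of_neg hDd, mul_div_assoc, h] at l2
      exact le_antisymm l1 l2
  tfae_have 3 → 4 := fun h => ⟨h.1, x₀, y₀, hxy₀, h.2 x₀ y₀ hxy₀⟩
  tfae_have 4 → 1 := by
    rintro ⟨h0, x, y, hxy, t1, t2⟩
    rw [hG.isTightEdge_iff hd2 hmem₁ (by linarith) h1k hxy, ← eq_div_iff hD₁.ne',
      mul_div_assoc] at t1
    rw [hG.isTightEdge_iff hd2 hmemd hdk (by linarith) hxy, ← eq_div_iff hDd.ne,
      mul_div_assoc] at t2
    exact mul_left_cancel₀ (mul_ne_zero h0 hb.ne') (t2.symm.trans t1)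
  tfae_finish
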